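/- Let $n, n_{in}, n_{mid} \in \mathbb{N}$ and let $G \le S_n$ be a group of permutations, acting on $x = (x_1,\dots,x_n) \in \mathbb{R}^{n\times n_{in}}$ (with rows $x_i\in\mathbb{R}^{n_{in}}$) by $g(x) = (x_{g(1)},\dots,x_{g(n)})$. Let $\mathcal{F}$ be a finite set of $G$-invariant real polynomials in the $n\cdot n_{in}$ entries of $x$ which generates the algebra of all $G$-invariant real polynomials in these entries, let $N_{inv} = |\mathcal{F}|$, and suppose that $n_{mid} \ge N_{inv}$. Let $\tau,\sigma:\mathbb{R}\to\mathbb{R}$ be continuous functions that are not polynomials ($\tau=\sigma$ is allowed). Let $V\subset\mathbb{R}^{n\times n_{in}}$ be compact, and let $f:V\to\mathbb{R}$ be continuous and $G$-invariant, that is, $f(g(x)) = f(x)$ whenever $g\in G$, $x\in V$ and $g(x)\in V$. Then for every $\varepsilon>0$ there are functions $\phi_1,\dots,\phi_n:\mathbb{R}^{n_{in}}\to\mathbb{R}^{n_{mid}}$ and $f_{out}:\mathbb{R}^{n_{mid}}\to\mathbb{R}$, each a neural network with one hidden layer, i.e. $$\phi_k(u)=\sum_{i=1}^{N_k} c^{(k)}_{i}\,\tau\Big(\sum_{j=1}^{n_{in}}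 w^{(k)}_{ij}u_j+h^{(k)}_i\Big),\qquad f_{out}(z)=\sum_{i=1}^{N} c_i\,\sigma\Big(\sum_{j=1}^{n_{mid}} w_{ij}z_j+h_i\Big)$$ with $N_k, N\ge 1$, $c^{(k)}_i\in\mathbb{R}^{n_{mid}}$ and all other coefficients real, such that the network $$\Gamma(x)=f_{out}\big(\Sigma\Pi(f_{in}(x))\big),\qquad f_{in}(x)=\big(\phi_j(x_i)\big)_{i,j=1}^n,\qquad \Sigma\Pi(y)=\sum_{g\in G}\prod_{j=1}^n y_{g(j),j}$$ (products of vectors in $\mathbb{R}^{n_{mid}}$ taken entrywise) satisfies $|f(x)-\Gamma(x)|<\varepsilon$ for all $x\in V$. -/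

import Mathlib

open scoped Classical in
/-- `ΣΠ(y) = ∑_{g ∈ G} ∏_{j} y_{g(j), j}` for an `n × n` array `y` of feature vectors in `ℝ^nMid`.
The products (and the sum) are taken entrywise in `Fin nMid → ℝ`. -/
noncomputable def sigmaPi {n nMid : ℕ} (G : Subgroup (Equiv.Perm (Fin n)))
    (y : Fin n → Fin n → (Fin nMid → ℝ)) : Fin nMid → ℝ :=
  ∑ g : G, ∏ j : Fin n, y ((g : Equiv.Perm (Fin n)) j) j

/-- The input transformation: the entry `(i, j)` of `f_in(x)` is `φ_j(x_i)`. -/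
def inputTransform {n nIn nMid : ℕ} (φ : Fin n → (Fin nIn → ℝ) → (Fin nMid → ℝ))
    (x : Fin n → Fin nIn → ℝ) : Fin n → Fin n → (Fin nMid → ℝ) :=
  fun i j => φ j (x i)

/-- The action of a permutation on the rows: `g(x) = (x_{g(1)}, …, x_{g(n)})`. -/
def permuteRows {n nIn : ℕ} (g : Equiv.Perm (Fin n)) (x : Fin n → Fin nIn → ℝ) :
    Fin n → Fin nIn → ℝ :=
  fun i => x (g i)

/-- A function on a set `V` of matrices is `G`-invariant if `f (g(x)) = f x` whenever `g ∈ G` and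
both `x` and `g(x)` lie in `V`. -/
def IsGInvariant {n nIn : ℕ} (G : Subgroup (Equiv.Perm (Fin n)))
    {V : Set (Fin n → Fin nIn → ℝ)} (f : V → ℝ) : Prop :=
  ∀ g ∈ G, ∀ (x : V) (hgx : permuteRows g (x : Fin n → Fin nIn → ℝ) ∈ V),
    f ⟨permuteRows g x, hgx⟩ = f x

/-- The algebra of `G`-invariant real polynomials in the entries `x_{i,k}` of an `n × nIn` matrix:
those unchanged by the substitutions `x_{i,k} ↦ x_{g(i),k}` for `g ∈ G`. -/
noncomputable def invariantPolynomials {n : ℕ} (nIn : ℕ) (G : Subgroup (Equiv.Perm (Fin n))) :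
    Subalgebra ℝ (MvPolynomial (Fin n × Fin nIn) ℝ) where
  carrier := {p | ∀ g ∈ G,
    MvPolynomial.rename (fun ik : Fin n × Fin nIn => (g ik.1, ik.2)) p = p}
  mul_mem' := fun ha hb g hg => by rw [map_mul, ha g hg, hb g hg]
  add_mem' := fun ha hb g hg => by rw [map_add, ha g hg, hb g hg]
  algebraMap_mem' := fun r g _ => AlgHom.commutes _ r

/-- `F` is a network with one hidden layer of some positive width `N` and activation `σ`:
`F(x) = ∑_i c_i σ(∑_j w_{ij} x_j + h_i)`. The output weights `c_i` lie in the output space `E`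
(`E = ℝ` for a scalar network, `E = ℝ^m` for a network with `m` outputs). -/
def IsOneHiddenLayerNetwork {d : ℕ} {E : Type*} [AddCommMonoid E] [Module ℝ E] (σ : ℝ → ℝ)
    (F : (Fin d → ℝ) → E) : Prop :=
  ∃ N : ℕ, 0 < N ∧ ∃ (c : Fin N → E) (w : Fin N → Fin d → ℝ) (h : Fin N → ℝ),
    ∀ x, F x = ∑ i, σ (∑ j, w i j * x j + h i) • c i

/-- `Γ = f_out ∘ ΣΠ ∘ f_in` is a `G`-invariant network with `nMid` features: `f_in` is built from
networks `φ_1, …, φ_n : ℝ^nIn → ℝ^nMid` with activation `τ`, and `f_out : ℝ^nMid → ℝ` is a network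
with activation `σ`. -/
def IsGInvariantNetwork {n nIn : ℕ} (nMid : ℕ) (G : Subgroup (Equiv.Perm (Fin n))) (τ σ : ℝ → ℝ)
    (Γ : (Fin n → Fin nIn → ℝ) → ℝ) : Prop :=
  ∃ (φ : Fin n → (Fin nIn → ℝ) → (Fin nMid → ℝ)) (fout : (Fin nMid → ℝ) → ℝ),
    (∀ j, IsOneHiddenLayerNetwork τ (φ j)) ∧ IsOneHiddenLayerNetwork σ fout ∧
      ∀ x, Γ x = fout (sigmaPi G (inputTransform φ x))

/-- A continuous activation function that is not a polynomial. -/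
def IsContinuousNonpolynomial (σ : ℝ → ℝ) : Prop :=
  Continuous σ ∧ ¬ ∃ p : Polynomial ℝ, ∀ t, σ t = p.eval t

open MeasureTheory Topology

/-! With monomials as input features, `sigmaPi` outputs orbit sums of monomials
(`sigmaPi_monomialFeature`). Some `nMid` orbit sums generate all invariants: those of nonconstant
monomials span the augmentation ideal `A`, and `A / A²` has dimension at most `F.card`, so that many
orbit sums span it and a graded Nakayama argument applies (`orbitSum_mem_adjoin`). Invariants
separate orbits, so on the compact `V` the function `f` is a continuous function of these orbit
sums.

It remains to replace this function and the monomials by networks, which are dense for a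
nonpolynomial activation (`dense_networkSubmodule`): derivatives in the weights of mollified neurons
give powers of linear forms, hence their exponentials, and Stone–Weierstrass concludes. -/

/-! ### Criteria for being a polynomial; integrals in closed subspaces -/

theorem exists_polynomial_of_iteratedDeriv_eq_zero {f : ℝ → ℝ} (hf : ContDiff ℝ (⊤ : ℕ∞) f) {k : ℕ}
    (hk : ∀ t, iteratedDeriv k f t = 0) :
    ∃ p : Polynomial ℝ, p.degree < (k + 1 : ℕ) ∧ ∀ t, f t = p.eval t := by
  -- The Lagrange remainder of the order-`k` Taylor polynomial involves derivative `k + 1`.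
  have hk' : ∀ t, iteratedDeriv (k + 1) f t = 0 := by
    intro t
    rw [iteratedDeriv_succ, funext hk]
    simp
  refine ⟨∑ i ∈ Finset.range (k + 1),
    Polynomial.C ((Nat.factorial i : ℝ)⁻¹ * iteratedDeriv i f 0) * Polynomial.X ^ i, ?_, ?_⟩
  · refine (Polynomial.degree_sum_le _ _).trans_lt ?_
    refine (Finset.sup_lt_iff (WithBot.bot_lt_coe _)).2 fun i hi => ?_
    refine (Polynomial.degree_C_mul_X_pow_le _ _).trans_lt ?_
    exact_mod_cast Finset.mem_range.1 hi
  · intro t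
    rw [Polynomial.eval_finsetSum]
    rcases eq_or_ne t 0 with rfl | ht
    · rw [Finset.sum_eq_single 0]
      · simp
      · intro i _ hi
        simp [hi]
      · simp
    · have hcont : ∀ m : ℕ, ContDiff ℝ m f := fun m => hf.of_le (by exact_mod_cast le_top)
      have hu : UniqueDiffOn ℝ (Set.uIcc 0 t) := uniqueDiffOn_Icc (by simpa using ht)
      have hw : ∀ m : ℕ, ∀ y ∈ Set.uIcc 0 t,
          iteratedDerivWithin m f (Set.uIcc 0 t) y = iteratedDeriv m f y := fun m y hy =>
        iteratedDerivWithin_eq_iteratedDeriv hu (hcont m).contDiffAt hy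
      have hd : DifferentiableOn ℝ (iteratedDerivWithin k f (Set.uIcc 0 t)) (Set.uIoo 0 t) := by
        refine DifferentiableOn.mono ?_ Set.uIoo_subset_uIcc_self
        refine ContDiffOn.differentiableOn_iteratedDerivWithin (n := (k + 1 : ℕ))
          (hcont _).contDiffOn (by exact_mod_cast Nat.lt_succ_self k) hu
      obtain ⟨y, hy, h⟩ := taylor_mean_remainder_lagrange (n := k) ht.symm
        (hcont k).contDiffOn hd
      rw [hw _ _ (Set.uIoo_subset_uIcc_self hy), hk', taylor_within_apply] at h
      simp only [zero_mul, zero_div, sub_eq_zero] at h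
      rw [h]
      refine Finset.sum_congr rfl fun i _ => ?_
      rw [hw _ _ Set.left_mem_uIcc]
      simp
      ring

/-- The uniform degree bound makes each `f i` the Lagrange interpolant of its values at `0, …, k -
1`, which depends continuously on these values. -/
theorem exists_polynomial_of_tendsto {ι : Type*} {l : Filter ι} [l.NeBot] {f : ι → ℝ → ℝ}
    {g : ℝ → ℝ} {k : ℕ}
    (hf : ∀ i, ∃ p : Polynomial ℝ, p.degree < (k : ℕ) ∧ ∀ t, f i t = p.eval t)
    (hg : ∀ t, Filter.Tendsto (fun i => f i t) l (𝓝 (g t))) :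
    ∃ p : Polynomial ℝ, ∀ t, g t = p.eval t := by
  choose p hdeg hp using hf
  have hinj : Set.InjOn (fun i : ℕ => (i : ℝ)) (Finset.range k) := Nat.cast_injective.injOn
  refine ⟨Lagrange.interpolate (Finset.range k) (fun i : ℕ => (i : ℝ)) (fun i => g i), fun t => ?_⟩
  refine tendsto_nhds_unique (hg t) ?_
  have h : ∀ i, f i t = (Lagrange.interpolate (Finset.range k) (fun i : ℕ => (i : ℝ))
      (fun j => f i j)).eval t := by
    intro i
    rw [hp, ← Lagrange.eq_interpolate_of_eval_eq (f := p i) _ hinj (by simpa using hdeg i)]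
    intro j _
    exact (hp i j).symm
  simp only [h, Lagrange.interpolate_apply, Polynomial.eval_finsetSum, Polynomial.eval_mul,
    Polynomial.eval_C]
  exact tendsto_finsetSum _ fun j _ => (hg j).mul_const _

theorem Submodule.integral_mem_of_isClosed {X E : Type*} [MeasurableSpace X] {μ : Measure X}
    [NormedAddCommGroup E] [NormedSpace ℝ E] [CompleteSpace E] {S : Submodule ℝ E}
    (hS : IsClosed (S : Set E)) {f : X → E} (hf : Integrable f μ) (hfS : ∀ x, f x ∈ S) :
    ∫ x, f x ∂μ ∈ S := by
  have : IsClosed (S : Set E) := hS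
  have h := S.mkQL.integral_comp_comm hf
  have h0 : ∀ x, S.mkQL (f x) = 0 := fun x => (Submodule.Quotient.mk_eq_zero S).2 (hfS x)
  simp only [h0, integral_zero] at h
  exact (Submodule.Quotient.mk_eq_zero S).1 h.symm

/-! ### Powers from ridge functions -/

section Ridge

variable {X : Type*} [TopologicalSpace X]

/-- The ridge function `x ↦ ψ (a * u x + b)`. -/
def ridge (ψ : C(ℝ, ℝ)) (u : C(X, ℝ)) (a b : ℝ) : C(X, ℝ) :=
  ψ.comp (a • u + ContinuousMap.const X b)

@[simp] theorem ridge_apply (ψ : C(ℝ, ℝ)) (u : C(X, ℝ)) (a b : ℝ) (x : X) :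
    ridge ψ u a b x = ψ (a * u x + b) := rfl

theorem continuous_ridge (ψ : C(ℝ, ℝ)) (u : C(X, ℝ)) :
    Continuous fun p : ℝ × ℝ => ridge ψ u p.1 p.2 := by
  refine ContinuousMap.continuous_of_continuous_uncurry _ ?_
  simp only [Function.uncurry_def, ridge_apply]
  fun_prop

variable [CompactSpace X]

/-- The derivative is in sup norm: the ridge function is an integral of a continuous `C(X,
ℝ)`-valued curve. -/
theorem hasDerivAt_ridge (ψ ψ' : C(ℝ, ℝ)) (h : ∀ t, HasDerivAt ψ (ψ' t) t) (u : C(X, ℝ))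
    (a b : ℝ) : HasDerivAt (fun a => ridge ψ u a b) (u * ridge ψ' u a b) a := by
  have hc : Continuous fun s => u * ridge ψ' u s b :=
    continuous_const.mul ((continuous_ridge ψ' u).comp (continuous_id.prodMk continuous_const))
  have key : ∀ s, ridge ψ u s b = (∫ r in (0 : ℝ)..s, u * ridge ψ' u r b) + ridge ψ u 0 b := by
    intro s
    ext x
    have := intervalIntegral.integral_eq_sub_of_hasDerivAt (a := 0) (b := s)
      (f := fun r => ψ (r * u x + b)) (f' := fun r => u x * ψ' (r * u x + b))
      (fun r _ => by
        have h1 : HasDerivAt (fun r : ℝ => r * u x + b) (u x) r := by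
          simpa using ((hasDerivAt_id r).mul_const (u x)).add_const b
        have h2 := (h (r * u x + b)).comp r h1
        rwa [mul_comm] at h2)
      (Continuous.intervalIntegrable (by fun_prop) _ _)
    have h2 := (ContinuousMap.evalCLM ℝ x).intervalIntegral_comp_comm
      (hc.intervalIntegrable (μ := volume) 0 s)
    simp only [ContinuousMap.evalCLM_apply] at h2
    rw [ContinuousMap.add_apply, ← h2]
    simp [this]
  rw [funext key]
  exact (intervalIntegral.integral_hasDerivAt_right (hc.intervalIntegrable _ _)
    (hc.stronglyMeasurableAtFilter _ _) hc.continuousAt).add_const _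

theorem pow_mul_ridge_iteratedDeriv_mem {S : Submodule ℝ C(X, ℝ)} (hS : IsClosed (S : Set C(X, ℝ)))
    {u : C(X, ℝ)} {ψ : C(ℝ, ℝ)} (hψ : ContDiff ℝ (⊤ : ℕ∞) ψ) (h : ∀ a b, ridge ψ u a b ∈ S)
    (k : ℕ) (a b : ℝ) :
    u ^ k * ridge ⟨iteratedDeriv k ψ, hψ.continuous_iteratedDeriv k (by exact_mod_cast le_top)⟩
      u a b ∈ S := by
  induction k generalizing a with
  | zero =>
    rw [pow_zero, one_mul]
    exact h a b
  | succ k ih =>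
    have hd := (hasDerivAt_ridge
      ⟨iteratedDeriv k ψ, hψ.continuous_iteratedDeriv k (by exact_mod_cast le_top)⟩
      ⟨iteratedDeriv (k + 1) ψ, hψ.continuous_iteratedDeriv (k + 1) (by exact_mod_cast le_top)⟩
      (fun t => by
        simp only [ContinuousMap.coe_mk, iteratedDeriv_succ]
        exact (hψ.differentiable_iteratedDeriv k (by exact_mod_cast WithTop.coe_lt_top k) t).hasDerivAt) u a b).const_mul (u ^ k)
    rw [← mul_assoc, ← pow_succ] at hd
    refine hS.mem_of_tendsto hd.tendsto_slope (Filter.Eventually.of_forall fun t => ?_)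
    exact S.smul_mem _ (S.sub_mem (ih _) (ih _))

theorem ridge_convolution_mem {S : Submodule ℝ C(X, ℝ)} (hS : IsClosed (S : Set C(X, ℝ)))
    {u : C(X, ℝ)} {σ : C(ℝ, ℝ)} (h : ∀ a b, ridge σ u a b ∈ S) {φ ψ : C(ℝ, ℝ)}
    (hφ : HasCompactSupport φ)
    (hψ : ∀ t, ψ t = ∫ s, φ s * σ (t - s)) (a b : ℝ) :
    ridge ψ u a b ∈ S := by
  have hc : Continuous fun s => φ s • ridge σ u a (b - s) :=
    φ.continuous.smul ((continuous_ridge σ u).comp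
      (continuous_const.prodMk (continuous_const.sub continuous_id)))
  have hi : Integrable fun s => φ s • ridge σ u a (b - s) :=
    hc.integrable_of_hasCompactSupport hφ.smul_right
  have key : ridge ψ u a b = ∫ s, φ s • ridge σ u a (b - s) := by
    ext x
    rw [ContinuousMap.integral_apply hi]
    simp [hψ, add_sub_assoc]
  rw [key]
  exact Submodule.integral_mem_of_isClosed hS hi fun s => S.smul_mem _ (h _ _)

/-- If `u ^ k ∉ S`, every mollification of `σ` has vanishing `k`-th derivative, hence is a
polynomial of degree at most `k`, and so is a polynomial in the limit. -/
theorem pow_mem_of_ridge_mem {S : Submodule ℝ C(X, ℝ)} (hS : IsClosed (S : Set C(X, ℝ)))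
    {u : C(X, ℝ)} {σ : C(ℝ, ℝ)} (hσ : ¬ ∃ p : Polynomial ℝ, ∀ t, σ t = p.eval t)
    (h : ∀ a b, ridge σ u a b ∈ S) (k : ℕ) : u ^ k ∈ S := by
  by_contra hu
  apply hσ
  let φ : ℕ → ContDiffBump (0 : ℝ) := fun i =>
    ⟨1 / (i + 1) / 2, 1 / (i + 1), by positivity, half_lt_self (by positivity)⟩
  let ψ : ℕ → ℝ → ℝ := fun i =>
    convolution ((φ i).normed volume) σ (ContinuousLinearMap.lsmul ℝ ℝ) volume
  have hφ : ∀ i, HasCompactSupport ((φ i).normed volume) := fun i =>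
    (φ i).hasCompactSupport_normed
  have hsm : ∀ i, ContDiff ℝ (⊤ : ℕ∞) (ψ i) := fun i =>
    (hφ i).contDiff_convolution_left _ (φ i).contDiff_normed σ.continuous.locallyIntegrable
  refine exists_polynomial_of_tendsto (l := Filter.atTop) (f := ψ) (k := k + 1) (fun i => ?_)
    fun t => ContDiffBump.convolution_tendsto_right_of_continuous
      tendsto_one_div_add_atTop_nhds_zero_nat σ.continuous t
  refine exists_polynomial_of_iteratedDeriv_eq_zero (hsm i) fun t => ?_
  by_contra hne
  apply hu
  -- At `a = 0` the ridge factor is the constant `iteratedDeriv k (ψ i) t`, which is nonzero.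
  have hmem := pow_mul_ridge_iteratedDeriv_mem hS (u := u) (ψ := ⟨ψ i, (hsm i).continuous⟩)
    (hsm i) (fun a b => ridge_convolution_mem hS h
      (φ := ⟨(φ i).normed volume, (φ i).continuous_normed⟩) (hφ i)
      (fun t => by simp [ψ, convolution_def]) a b) k 0 t
  convert S.smul_mem (iteratedDeriv k (ψ i) t)⁻¹ hmem using 1
  ext x
  simp
  field_simp

end Ridge

/-! ### Closure properties of networks -/

section Networks

variable {d : ℕ} {E : Type*} [AddCommGroup E] [Module ℝ E]

theorem isOneHiddenLayerNetwork_neuron (σ : ℝ → ℝ) (c : E) (w : Fin d → ℝ) (h : ℝ) :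
    IsOneHiddenLayerNetwork σ fun x => σ (∑ j, w j * x j + h) • c :=
  ⟨1, one_pos, fun _ => c, fun _ => w, fun _ => h, fun x => by simp⟩

theorem isOneHiddenLayerNetwork_zero (σ : ℝ → ℝ) :
    IsOneHiddenLayerNetwork σ (0 : (Fin d → ℝ) → E) :=
  ⟨1, one_pos, 0, 0, 0, fun x => by simp⟩

theorem IsOneHiddenLayerNetwork.add {σ : ℝ → ℝ} {F F' : (Fin d → ℝ) → E}
    (hF : IsOneHiddenLayerNetwork σ F) (hF' : IsOneHiddenLayerNetwork σ F') :
    IsOneHiddenLayerNetwork σ (F + F') := by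
  obtain ⟨N, hN, c, w, h, hx⟩ := hF
  obtain ⟨N', -, c', w', h', hx'⟩ := hF'
  refine ⟨N + N', by omega, Fin.append c c', Fin.append w w', Fin.append h h', fun x => ?_⟩
  simp [Fin.sum_univ_add, hx, hx']

theorem IsOneHiddenLayerNetwork.smul {σ : ℝ → ℝ} {F : (Fin d → ℝ) → E}
    (hF : IsOneHiddenLayerNetwork σ F) (a : ℝ) : IsOneHiddenLayerNetwork σ (a • F) := by
  obtain ⟨N, hN, c, w, h, hx⟩ := hF
  refine ⟨N, hN, a • c, w, h, fun x => ?_⟩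
  simp [hx, Finset.smul_sum, smul_comm a]

theorem IsOneHiddenLayerNetwork.continuous {E : Type*} [NormedAddCommGroup E] [NormedSpace ℝ E]
    {σ : ℝ → ℝ} (hσ : Continuous σ) {F : (Fin d → ℝ) → E} (hF : IsOneHiddenLayerNetwork σ F) :
    Continuous F := by
  obtain ⟨N, hN, c, w, h, hx⟩ := hF
  rw [funext hx]
  fun_prop

end Networks

/-! ### Density of networks -/

section Density

variable {d : ℕ} (K : Set (Fin d → ℝ)) (σ : ℝ → ℝ)

/-- The continuous functions on `K` that are restrictions of networks with one hidden layer. -/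
def networkSubmodule (E : Type*) [NormedAddCommGroup E] [NormedSpace ℝ E] :
    Submodule ℝ C(K, E) where
  carrier := {f | ∃ F : (Fin d → ℝ) → E, IsOneHiddenLayerNetwork σ F ∧ ∀ x : K, f x = F x}
  zero_mem' := ⟨0, isOneHiddenLayerNetwork_zero σ, fun _ => rfl⟩
  add_mem' := by
    rintro f g ⟨F, hF, hf⟩ ⟨G, hG, hg⟩
    exact ⟨F + G, hF.add hG, fun x => by simp [hf, hg]⟩
  smul_mem' := by
    rintro a f ⟨F, hF, hf⟩
    exact ⟨a • F, hF.smul a, fun x => by simp [hf]⟩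

/-- The restriction to `K` of the linear form with coefficients `w`. -/
def linearForm (w : Fin d → ℝ) : C(K, ℝ) where
  toFun x := ∑ j, w j * (x : Fin d → ℝ) j
  continuous_toFun := continuous_finsetSum _ fun j _ =>
    continuous_const.mul ((continuous_apply j).comp continuous_subtype_val)

theorem linearForm_apply (w : Fin d → ℝ) (x : K) :
    linearForm K w x = ∑ j, w j * (x : Fin d → ℝ) j := rfl

theorem linearForm_add (w w' : Fin d → ℝ) :
    linearForm K (w + w') = linearForm K w + linearForm K w' := by
  ext x
  simp [linearForm_apply, add_mul, Finset.sum_add_distrib]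

variable [CompactSpace K] {σ}

theorem exp_mem_of_pow_mem {X : Type*} [TopologicalSpace X] [CompactSpace X]
    {S : Submodule ℝ C(X, ℝ)} (hS : IsClosed (S : Set C(X, ℝ))) {u : C(X, ℝ)}
    (h : ∀ k : ℕ, u ^ k ∈ S) : NormedSpace.exp u ∈ S :=
  hS.mem_of_tendsto (NormedSpace.exp_series_hasSum_exp' (𝕂 := ℝ) u)
    (Filter.Eventually.of_forall fun _ => S.sum_mem fun k _ => S.smul_mem _ (h k))

theorem ContinuousMap.exp_apply {X : Type*} [TopologicalSpace X] [CompactSpace X]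
    (u : C(X, ℝ)) (x : X) : NormedSpace.exp u x = Real.exp (u x) := by
  rw [Real.exp_eq_exp_ℝ]
  exact NormedSpace.map_exp (ContinuousMap.evalAlgHom ℝ ℝ x) (ContinuousEvalConst.continuous_eval_const x) u

/-- Exponentials of linear forms are closed under products, so their span is already a
point-separating algebra. -/
theorem eq_top_of_exp_linearForm_mem {S : Submodule ℝ C(K, ℝ)} (hS : IsClosed (S : Set C(K, ℝ)))
    (h : ∀ w, NormedSpace.exp (linearForm K w) ∈ S) : S = ⊤ := by
  let A : Subalgebra ℝ C(K, ℝ) :=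
    Algebra.adjoin ℝ (Set.range fun w => NormedSpace.exp (linearForm K w))
  have hA : A.SeparatesPoints := by
    intro x y hxy
    obtain ⟨j, hj⟩ : ∃ j, (x : Fin d → ℝ) j ≠ (y : Fin d → ℝ) j := by
      by_contra! hc
      exact hxy (Subtype.ext (funext hc))
    refine ⟨_, ⟨_, Algebra.subset_adjoin ⟨Pi.single j 1, rfl⟩, rfl⟩, ?_⟩
    simpa [ContinuousMap.exp_apply, linearForm_apply, Pi.single_apply] using hj
  have hAS : Subalgebra.toSubmodule A ≤ S := by
    rw [Algebra.adjoin_eq_span, Submodule.span_le]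
    intro f hf
    suffices ∃ w, f = NormedSpace.exp (linearForm K w) by
      obtain ⟨w, rfl⟩ := this
      exact h w
    induction hf using Submonoid.closure_induction with
    | mem f hf =>
      obtain ⟨w, rfl⟩ := hf
      exact ⟨w, rfl⟩
    | one =>
      refine ⟨0, ?_⟩
      ext x
      simp [ContinuousMap.exp_apply, linearForm_apply]
    | mul f g _ _ hf hg =>
      obtain ⟨w, rfl⟩ := hf
      obtain ⟨w', rfl⟩ := hg
      refine ⟨w + w', ?_⟩
      ext x
      simp [ContinuousMap.exp_apply, linearForm_add, Real.exp_add]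
  rw [eq_top_iff]
  intro f _
  have hf := ContinuousMap.continuousMap_mem_subalgebra_closure_of_separatesPoints A hA f
  exact closure_minimal hAS hS hf

theorem dense_networkSubmodule_real (hσ : IsContinuousNonpolynomial σ) :
    (networkSubmodule K σ ℝ).topologicalClosure = ⊤ := by
  have hS := (networkSubmodule K σ ℝ).isClosed_topologicalClosure
  refine eq_top_of_exp_linearForm_mem K hS fun w => exp_mem_of_pow_mem hS fun k =>
    pow_mem_of_ridge_mem (σ := ⟨σ, hσ.1⟩) hS hσ.2 (fun a b => ?_) k
  refine Submodule.le_topologicalClosure _ ⟨_, isOneHiddenLayerNetwork_neuron σ 1 (a • w) b, ?_⟩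
  intro x
  simp [linearForm_apply, Finset.mul_sum, mul_assoc]

theorem dense_networkSubmodule (hσ : IsContinuousNonpolynomial σ) (m : ℕ) :
    Dense (networkSubmodule K σ (Fin m → ℝ) : Set C(K, Fin m → ℝ)) := by
  rw [Submodule.dense_iff_topologicalClosure_eq_top, eq_top_iff]
  intro f _
  let T : Fin m → C(K, ℝ) →L[ℝ] C(K, Fin m → ℝ) := fun i =>
    (ContinuousLinearMap.single ℝ (fun _ : Fin m => ℝ) i).compLeftContinuous ℝ K
  have hT : ∀ i g x, T i g x = Pi.single i (g x) := fun _ _ _ => rfl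
  have hf : f = ∑ i, T i ((ContinuousMap.mk fun y : Fin m → ℝ => y i).comp f) := by
    ext x j
    simp [hT, Finset.sum_apply, Pi.single_apply]
  rw [hf]
  refine Submodule.sum_mem _ fun i _ => ?_
  have hmem : ∀ g : C(K, ℝ), T i g ∈ (networkSubmodule K σ (Fin m → ℝ)).topologicalClosure := by
    intro g
    have hg : g ∈ (networkSubmodule K σ ℝ).topologicalClosure := by
      rw [dense_networkSubmodule_real K hσ]; trivial
    refine map_mem_closure (T i).continuous hg ?_
    rintro g ⟨F, ⟨N, hN, c, w, h, hF⟩, hg⟩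
    refine ⟨fun x => Pi.single i (F x), ⟨N, hN, fun k => Pi.single i (c k), w, h, fun x => ?_⟩, ?_⟩
    · ext j
      rcases eq_or_ne j i with rfl | hj
      · simp [hF]
      · simp [hj]
    · intro x
      simp [hT, hg]
  exact hmem _

end Density

/-! ### Generating the invariants by few orbit sums -/

/-- Modulo `W`, the span of `s` has dimension at most `t.card`, and a basis can be picked from the
image of `s` itself. -/
theorem Submodule.exists_fin_span_le_sup {k E : Type*} [Field k] [AddCommGroup E] [Module k E]
    (W : Submodule k E) {s : Set E} (t : Finset E) (hs : s ⊆ (span k (t : Set E) ⊔ W : Submodule k E)) :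
    ∃ r ≤ t.card, ∃ b : Fin r → E, (∀ i, b i ∈ s) ∧ span k s ≤ span k (Set.range b) ⊔ W := by
  classical
  have hspan : span k (W.mkQ '' s) ≤ span k (t.image W.mkQ : Set (E ⧸ W)) := by
    rw [← map_span, Finset.coe_image, ← map_span]
    have h := map_mono (f := W.mkQ) (span_le.2 hs)
    rwa [map_sup, mkQ_map_self, sup_bot_eq] at h
  have hr : Module.finrank k (span k (W.mkQ '' s)) ≤ t.card :=
    (finrank_mono hspan).trans ((finrank_span_finset_le_card _).trans Finset.card_image_le)
  have : FiniteDimensional k (span k (W.mkQ '' s)) := finiteDimensional_of_le hspan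
  obtain ⟨b, hb, hbs, -⟩ := exists_fun_fin_finrank_span_eq k (W.mkQ '' s)
  choose e hes he using hb
  refine ⟨_, hr, e, hes, ?_⟩
  have hle : (span k s).map W.mkQ ≤ (span k (Set.range e)).map W.mkQ := by
    rw [map_span, map_span, ← Set.range_comp, show W.mkQ ∘ e = b from funext he]
    exact hbs.ge
  rwa [map_le_iff_le_comap, comap_map_mkQ, sup_comm] at hle

section Invariants

open MvPolynomial
open scoped Classical

variable {n nIn : ℕ} (G : Subgroup (Equiv.Perm (Fin n)))

/-- The sum over `G` of the images of a monomial. -/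
noncomputable def orbitSum (m : Fin n × Fin nIn →₀ ℕ) : MvPolynomial (Fin n × Fin nIn) ℝ :=
  ∑ g : G, rename (fun ik : Fin n × Fin nIn => ((g : Equiv.Perm (Fin n)) ik.1, ik.2))
    (monomial m 1)

theorem orbitSum_mem (m : Fin n × Fin nIn →₀ ℕ) :
    orbitSum G m ∈ invariantPolynomials nIn G := by
  intro g hg
  simp only [orbitSum, map_sum, rename_rename]
  exact Fintype.sum_equiv (Equiv.mulLeft (⟨g, hg⟩ : G)) _ _ fun h => rfl

theorem isHomogeneous_orbitSum (m : Fin n × Fin nIn →₀ ℕ) :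
    (orbitSum G m).IsHomogeneous m.degree :=
  IsHomogeneous.sum _ _ _ fun _ _ => (isHomogeneous_monomial 1 rfl).rename_isHomogeneous

theorem orbitSum_zero : orbitSum G (0 : Fin n × Fin nIn →₀ ℕ) = C (Fintype.card G : ℝ) := by
  simp [orbitSum]

/-- Averaging over `G` fixes `p` and sends each monomial to a multiple of its orbit sum. -/
theorem eq_sum_orbitSum {p : MvPolynomial (Fin n × Fin nIn) ℝ}
    (hp : p ∈ invariantPolynomials nIn G) :
    p = ∑ m ∈ p.support, ((Fintype.card G : ℝ)⁻¹ * p.coeff m) • orbitSum G m := by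
  have hcard : (Fintype.card G : ℝ) ≠ 0 := by exact_mod_cast Fintype.card_ne_zero
  have h : (Fintype.card G : ℝ) • p = ∑ m ∈ p.support, p.coeff m • orbitSum G m := by
    calc (Fintype.card G : ℝ) • p = ∑ g : G,
        rename (fun ik : Fin n × Fin nIn => ((g : Equiv.Perm (Fin n)) ik.1, ik.2)) p := by
          rw [Finset.sum_congr rfl fun (g : G) _ => hp g g.2]
          simp [Nat.cast_smul_eq_nsmul]
      _ = _ := by
          simp only [orbitSum, Finset.smul_sum]
          rw [Finset.sum_comm]
          refine Finset.sum_congr rfl fun g _ => ?_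
          conv_lhs => rw [p.as_sum]
          rw [map_sum]
          refine Finset.sum_congr rfl fun m _ => ?_
          rw [← map_smul, smul_monomial, smul_eq_mul, mul_one]
  simp only [mul_smul, ← Finset.smul_sum, ← h]
  rw [smul_smul, inv_mul_cancel₀ hcard, one_smul]

/-- The span of the orbit sums of nonconstant monomials. -/
noncomputable def augmentation : Submodule ℝ (MvPolynomial (Fin n × Fin nIn) ℝ) :=
  Submodule.span ℝ (orbitSum G '' {m | m ≠ 0})

theorem mem_augmentation {p : MvPolynomial (Fin n × Fin nIn) ℝ}
    (hp : p ∈ invariantPolynomials nIn G) (h0 : constantCoeff p = 0) :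
    p ∈ augmentation G := by
  rw [eq_sum_orbitSum G hp]
  refine Submodule.sum_mem _ fun m hm => Submodule.smul_mem _ _ (Submodule.subset_span ⟨m, ?_, rfl⟩)
  rintro rfl
  exact (mem_support_iff.1 hm) h0

theorem sub_constantCoeff_mem_augmentation {p : MvPolynomial (Fin n × Fin nIn) ℝ}
    (hp : p ∈ invariantPolynomials nIn G) : p - C (constantCoeff p) ∈ augmentation G :=
  mem_augmentation G (sub_mem hp ((invariantPolynomials nIn G).algebraMap_mem _)) (by simp)

theorem constantCoeff_orbitSum {m : Fin n × Fin nIn →₀ ℕ} (hm : m ≠ 0) :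
    constantCoeff (orbitSum G m) = 0 := by
  simp [orbitSum, map_sum, constantCoeff_monomial, hm]

theorem sub_constantCoeff_mem_span_sup {F : Set (MvPolynomial (Fin n × Fin nIn) ℝ)}
    (hF : Algebra.adjoin ℝ F = invariantPolynomials nIn G)
    {p : MvPolynomial (Fin n × Fin nIn) ℝ} (hp : p ∈ invariantPolynomials nIn G) :
    p - C (constantCoeff p) ∈
      Submodule.span ℝ ((fun q => q - C (constantCoeff q)) '' F) ⊔ augmentation G * augmentation G := by
  rw [← hF] at hp
  induction hp using Algebra.adjoin_induction with
  | mem p hp => exact Submodule.mem_sup_left (Submodule.subset_span ⟨p, hp, rfl⟩)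
  | algebraMap r => simp [algebraMap_eq]
  | add p q _ _ hp hq =>
    convert add_mem hp hq using 1
    simp only [map_add]
    ring
  | mul p q hpm hqm hp hq =>
    rw [hF] at hpm hqm
    have h := Submodule.mem_sup_right
      (S := Submodule.span ℝ ((fun q => q - C (constantCoeff q)) '' F))
      (Submodule.mul_mem_mul (sub_constantCoeff_mem_augmentation G hpm)
        (sub_constantCoeff_mem_augmentation G hqm))
    -- With constant terms `a`, `b`: `pq - ab = (p - a)(q - b) + a(q - b) + b(p - a)`.
    convert add_mem h (add_mem (Submodule.smul_mem _ (constantCoeff p) hq)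
      (Submodule.smul_mem _ (constantCoeff q) hp)) using 1
    simp only [map_mul, smul_eq_C_mul]
    ring

theorem exists_orbitSum_span_sup (F : Finset (MvPolynomial (Fin n × Fin nIn) ℝ))
    (hF : Algebra.adjoin ℝ (F : Set (MvPolynomial (Fin n × Fin nIn) ℝ)) =
      invariantPolynomials nIn G) :
    ∃ r ≤ F.card, ∃ e : Fin r → (Fin n × Fin nIn →₀ ℕ),
      augmentation G ≤ Submodule.span ℝ (Set.range (orbitSum G ∘ e)) ⊔
        augmentation G * augmentation G := by
  obtain ⟨r, hr, b, hb, hle⟩ := Submodule.exists_fin_span_le_sup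
    (augmentation (nIn := nIn) G * augmentation G)
    (s := orbitSum G '' {m | m ≠ 0}) (F.image fun q => q - C (constantCoeff q)) (by
      rintro _ ⟨m, hm, rfl⟩
      have h := sub_constantCoeff_mem_span_sup G hF (orbitSum_mem G m)
      rwa [constantCoeff_orbitSum G hm, map_zero, sub_zero, ← Finset.coe_image] at h)
  choose e _ he using hb
  refine ⟨r, hr.trans Finset.card_image_le, e, ?_⟩
  rw [show orbitSum G ∘ e = b from funext he]
  exact hle

/-- Graded Nakayama, by induction on degree: in the component of degree `m.degree`, a product from
the square of the augmentation has two factors of positive, hence strictly smaller, degree. -/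
theorem orbitSum_mem_adjoin {T : Set (Fin n × Fin nIn →₀ ℕ)}
    (hT : augmentation G ≤ Submodule.span ℝ (orbitSum G '' T) ⊔ augmentation G * augmentation G)
    (m : Fin n × Fin nIn →₀ ℕ) : orbitSum G m ∈ Algebra.adjoin ℝ (orbitSum G '' T) := by
  induction hd : m.degree using Nat.strong_induction_on generalizing m with
  | _ d ih =>
  subst hd
  by_cases hm : m = 0
  · rw [hm, orbitSum_zero]
    exact Subalgebra.algebraMap_mem _ _
  have hcomp : ∀ e : Fin n × Fin nIn →₀ ℕ, homogeneousComponent m.degree (orbitSum G e) =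
      if e.degree = m.degree then orbitSum G e else 0 := fun e => by
    rw [homogeneousComponent_of_mem (isHomogeneous_orbitSum G e)]
    simp only [eq_comm]
  have hle : Submodule.span ℝ (orbitSum G '' T) ⊔ augmentation G * augmentation G ≤
      (Subalgebra.toSubmodule (Algebra.adjoin ℝ (orbitSum G '' T))).comap
        (homogeneousComponent m.degree) := by
    rw [augmentation, Submodule.span_mul_span, sup_le_iff, Submodule.span_le, Submodule.span_le]
    constructor
    · rintro _ ⟨e, he, rfl⟩
      simp only [Submodule.comap_coe, Set.mem_preimage, SetLike.mem_coe,
        Subalgebra.mem_toSubmodule, hcomp]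
      split_ifs
      · exact Algebra.subset_adjoin ⟨e, he, rfl⟩
      · exact zero_mem _
    · rintro _ ⟨_, ⟨p, hp, rfl⟩, _, ⟨q, hq, rfl⟩, rfl⟩
      simp only [Submodule.comap_coe, Set.mem_preimage, SetLike.mem_coe,
        Subalgebra.mem_toSubmodule]
      rw [homogeneousComponent_of_mem
        ((isHomogeneous_orbitSum G p).mul (isHomogeneous_orbitSum G q))]
      have hp' : p.degree ≠ 0 := mt (Finsupp.degree_eq_zero_iff p).1 hp
      have hq' : q.degree ≠ 0 := mt (Finsupp.degree_eq_zero_iff q).1 hq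
      split_ifs with h
      · exact mul_mem (ih _ (by omega) p rfl) (ih _ (by omega) q rfl)
      · exact zero_mem _
  have h := hle (hT (Submodule.subset_span ⟨m, hm, rfl⟩))
  rw [Submodule.mem_comap, hcomp, if_pos rfl] at h
  exact h

theorem exists_orbitSum_adjoin (F : Finset (MvPolynomial (Fin n × Fin nIn) ℝ))
    (hF : Algebra.adjoin ℝ (F : Set (MvPolynomial (Fin n × Fin nIn) ℝ)) =
      invariantPolynomials nIn G) {N : ℕ} (hN : F.card ≤ N) :
    ∃ e : Fin N → (Fin n × Fin nIn →₀ ℕ),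
      invariantPolynomials nIn G ≤ Algebra.adjoin ℝ (Set.range fun k => orbitSum G (e k)) := by
  obtain ⟨r, hr, e, he⟩ := exists_orbitSum_span_sup G F hF
  rw [Set.range_comp] at he
  -- Surplus features get exponent `0`, whose orbit sum is a harmless constant.
  refine ⟨fun k => if h : (k : ℕ) < r then e ⟨k, h⟩ else 0, fun p hp => ?_⟩
  rw [eq_sum_orbitSum G hp]
  refine sum_mem fun m _ => Subalgebra.smul_mem _ (Algebra.adjoin_mono ?_
    (orbitSum_mem_adjoin G he m)) _
  rintro _ ⟨_, ⟨i, rfl⟩, rfl⟩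
  exact ⟨⟨i, by omega⟩, by simp⟩

theorem eval_orbitSum (m : Fin n × Fin nIn →₀ ℕ) (x : Fin n → Fin nIn → ℝ) :
    eval (fun ik => x ik.1 ik.2) (orbitSum G m) =
      ∑ g : G, ∏ j, ∏ l, x ((g : Equiv.Perm (Fin n)) j) l ^ m (j, l) := by
  simp only [orbitSum, map_sum, eval_rename, eval_monomial, one_mul]
  refine Finset.sum_congr rfl fun g _ => ?_
  rw [Finsupp.prod_fintype _ _ (fun _ => pow_zero _), Fintype.prod_prod_type]
  rfl

/-- The invariant polynomials separate the orbits. -/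
theorem exists_permuteRows_of_eval_eq {x y : Fin n → Fin nIn → ℝ}
    (h : ∀ p ∈ invariantPolynomials nIn G,
      eval (fun ik => x ik.1 ik.2) p = eval (fun ik => y ik.1 ik.2) p) :
    ∃ g ∈ G, y = permuteRows g x := by
  -- A product of squared Euclidean distances to the points `permuteRows g x`; its real zeros are
  -- exactly the orbit of `x`.
  let p : MvPolynomial (Fin n × Fin nIn) ℝ :=
    ∏ g : G, ∑ i, ∑ k, (X (i, k) - C (x ((g : Equiv.Perm (Fin n)) i) k)) ^ 2
  have hp : p ∈ invariantPolynomials nIn G := by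
    intro g hg
    simp only [p, map_prod, map_sum, map_pow, map_sub, rename_X, rename_C]
    refine Fintype.prod_equiv (Equiv.mulRight (⟨g, hg⟩⁻¹ : G)) _ _ fun a => ?_
    refine Fintype.sum_equiv g _ _ fun i => ?_
    simp
  have hx : eval (fun ik => x ik.1 ik.2) p = 0 := by
    simp only [p, map_prod]
    exact Finset.prod_eq_zero (Finset.mem_univ 1) (by simp)
  have hy := (h p hp).symm.trans hx
  simp only [p, map_prod, Finset.prod_eq_zero_iff, Finset.mem_univ, true_and, map_sum, map_pow,
    map_sub, eval_X, eval_C] at hy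
  obtain ⟨g, hg⟩ := hy
  refine ⟨g, g.2, funext fun i => funext fun k => ?_⟩
  rw [Finset.sum_eq_zero_iff_of_nonneg fun i _ => Finset.sum_nonneg fun k _ => sq_nonneg _] at hg
  have hi := hg i (Finset.mem_univ i)
  rw [Finset.sum_eq_zero_iff_of_nonneg fun k _ => sq_nonneg _] at hi
  have := hi k (Finset.mem_univ k)
  exact sub_eq_zero.1 (pow_eq_zero_iff two_ne_zero |>.1 this)

end Invariants

/-! ### Factorization through the invariants and assembly of the network -/

/-- A continuous map from a compact space to a Hausdorff one is closed, hence a quotient map onto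
its range. -/
theorem ContinuousMap.exists_eq_comp_of_factorsThrough {X Y : Type*} [TopologicalSpace X]
    [TopologicalSpace Y] [CompactSpace X] [T2Space Y] (q : C(X, Y)) (f : C(X, ℝ))
    (h : Function.FactorsThrough f q) :
    ∃ g : C(Set.range q, ℝ), ∀ x, g ⟨q x, x, rfl⟩ = f x := by
  let p : C(X, Set.range q) := ⟨Set.rangeFactorization q, q.continuous.subtype_mk _⟩
  have hp : IsQuotientMap p :=
    p.continuous.isClosedMap.isQuotientMap p.continuous Set.rangeFactorization_surjective
  have hf : Function.FactorsThrough f p := fun x y hxy => h (congrArg Subtype.val hxy)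
  exact ⟨hp.lift f hf, fun x => DFunLike.congr_fun (hp.lift_comp f hf) x⟩

theorem exists_network_dist_lt {d : ℕ} (K : Set (Fin d → ℝ)) [CompactSpace K] {σ : ℝ → ℝ}
    (hσ : IsContinuousNonpolynomial σ) (g : C(K, ℝ)) {ε : ℝ} (hε : 0 < ε) :
    ∃ F : (Fin d → ℝ) → ℝ, IsOneHiddenLayerNetwork σ F ∧ ∀ x : K, |g x - F x| < ε := by
  have hg : g ∈ (networkSubmodule K σ ℝ).topologicalClosure := by
    rw [dense_networkSubmodule_real K hσ]
    trivial
  obtain ⟨g', ⟨F, hF, hgF⟩, hd⟩ := Metric.mem_closure_iff.1 hg ε hε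
  refine ⟨F, hF, fun x => ?_⟩
  rw [← hgF, ← Real.dist_eq]
  exact (ContinuousMap.dist_apply_le_dist x).trans_lt hd

theorem eval_eq_of_mem_adjoin {ι : Type*} {T : Set (MvPolynomial ι ℝ)} {x y : ι → ℝ}
    (h : ∀ p ∈ T, MvPolynomial.eval x p = MvPolynomial.eval y p) {p : MvPolynomial ι ℝ}
    (hp : p ∈ Algebra.adjoin ℝ T) : MvPolynomial.eval x p = MvPolynomial.eval y p := by
  induction hp using Algebra.adjoin_induction with
  | mem p hp => exact h p hp
  | algebraMap r => simp [MvPolynomial.algebraMap_eq]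
  | add p q _ _ hp hq => simp [hp, hq]
  | mul p q _ _ hp hq => simp [hp, hq]

section

variable {n nIn nMid : ℕ} (G : Subgroup (Equiv.Perm (Fin n)))

/-- The input transformation whose features are the values of monomials. -/
def monomialFeature (e : Fin nMid → (Fin n × Fin nIn →₀ ℕ)) (j : Fin n) (u : Fin nIn → ℝ) :
    Fin nMid → ℝ :=
  fun k => ∏ l, u l ^ e k (j, l)

theorem continuous_monomialFeature (e : Fin nMid → (Fin n × Fin nIn →₀ ℕ)) (j : Fin n) :
    Continuous (monomialFeature e j) := by
  unfold monomialFeature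
  fun_prop

theorem sigmaPi_monomialFeature (e : Fin nMid → (Fin n × Fin nIn →₀ ℕ))
    (x : Fin n → Fin nIn → ℝ) (k : Fin nMid) :
    sigmaPi G (inputTransform (monomialFeature e) x) k =
      MvPolynomial.eval (fun ik => x ik.1 ik.2) (orbitSum G (e k)) := by
  rw [eval_orbitSum]
  simp [sigmaPi, inputTransform, monomialFeature, Finset.sum_apply, Finset.prod_apply]

theorem continuous_sigmaPi_inputTransform {φ : Fin n → (Fin nIn → ℝ) → (Fin nMid → ℝ)}
    (hφ : ∀ j, Continuous (φ j)) : Continuous fun x => sigmaPi G (inputTransform φ x) := by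
  unfold sigmaPi inputTransform
  fun_prop

/-- Perturbing the input transformation to networks changes the output arbitrarily little. -/
theorem exists_network_inputTransform {τ : ℝ → ℝ} (hτ : IsContinuousNonpolynomial τ)
    {V : Set (Fin n → Fin nIn → ℝ)} (hV : IsCompact V)
    {φ : Fin n → (Fin nIn → ℝ) → (Fin nMid → ℝ)} (hφ : ∀ j, Continuous (φ j))
    {F : (Fin nMid → ℝ) → ℝ} (hF : Continuous F) {ε : ℝ} (hε : 0 < ε) :
    ∃ φ' : Fin n → (Fin nIn → ℝ) → (Fin nMid → ℝ), (∀ j, IsOneHiddenLayerNetwork τ (φ' j)) ∧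
      ∀ x ∈ V, |F (sigmaPi G (inputTransform φ x)) - F (sigmaPi G (inputTransform φ' x))| < ε := by
  classical
  -- All rows of points of `V` lie in `K`, so each `φ j` matters only there.
  let K : Set (Fin nIn → ℝ) := ⋃ i : Fin n, (fun x : Fin n → Fin nIn → ℝ => x i) '' V
  have hK : IsCompact K := isCompact_iUnion fun i => hV.image (continuous_apply i)
  have : CompactSpace K := isCompact_iff_compactSpace.1 hK
  have : CompactSpace V := isCompact_iff_compactSpace.1 hV
  let row : Fin n → C(V, K) := fun i =>
    ⟨fun x => ⟨(x : Fin n → Fin nIn → ℝ) i, Set.mem_iUnion.2 ⟨i, x, x.2, rfl⟩⟩,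
      ((continuous_apply i).comp continuous_subtype_val).subtype_mk _⟩
  let T : (Fin n → C(K, Fin nMid → ℝ)) → C(V, ℝ) := fun ψ =>
    ⟨fun x => F (∑ g : G, ∏ j, ψ j (row ((g : Equiv.Perm (Fin n)) j) x)), by fun_prop⟩
  have hT : Continuous T := by
    refine ContinuousMap.continuous_of_continuous_uncurry _ ?_
    simp only [Function.uncurry_def, T, ContinuousMap.coe_mk]
    fun_prop
  let φK : Fin n → C(K, Fin nMid → ℝ) := fun j => ⟨fun u => φ j u, by fun_prop⟩
  -- Continuity of `T` and density of tuples of networks replace explicit error estimates.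
  have hdense : Dense (Set.univ.pi fun _ : Fin n =>
      (networkSubmodule K τ (Fin nMid → ℝ) : Set C(K, Fin nMid → ℝ))) :=
    dense_pi _ fun _ _ => dense_networkSubmodule K hτ nMid
  obtain ⟨ψ, hψ, hψN⟩ := hdense.inter_open_nonempty _
    (Metric.isOpen_ball.preimage hT : IsOpen (T ⁻¹' Metric.ball (T φK) ε))
    ⟨φK, Metric.mem_ball_self hε⟩
  choose φ' hφ' hψφ' using fun j => hψN j trivial
  refine ⟨φ', hφ', fun x hx => ?_⟩
  have h1 : T φK ⟨x, hx⟩ = F (sigmaPi G (inputTransform φ x)) := rfl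
  have h2 : T ψ ⟨x, hx⟩ = F (sigmaPi G (inputTransform φ' x)) := by
    simp only [T, ContinuousMap.coe_mk, hψφ']
    rfl
  rw [← h1, ← h2, ← Real.dist_eq, dist_comm]
  exact (ContinuousMap.dist_apply_le_dist _).trans_lt hψ

end

theorem proposition1 {n nIn nMid : ℕ} (G : Subgroup (Equiv.Perm (Fin n)))
    (F : Finset (MvPolynomial (Fin n × Fin nIn) ℝ))
    (hF : Algebra.adjoin ℝ (F : Set (MvPolynomial (Fin n × Fin nIn) ℝ)) =
      invariantPolynomials nIn G)
    (hMid : F.card ≤ nMid)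
    (τ σ : ℝ → ℝ) (hτ : IsContinuousNonpolynomial τ) (hσ : IsContinuousNonpolynomial σ)
    (V : Set (Fin n → Fin nIn → ℝ)) (hV : IsCompact V)
    (f : V → ℝ) (hf : Continuous f) (hinv : IsGInvariant G f)
    (ε : ℝ) (hε : 0 < ε) :
    ∃ Γ : (Fin n → Fin nIn → ℝ) → ℝ, IsGInvariantNetwork nMid G τ σ Γ ∧
      ∀ x : V, |f x - Γ x| < ε := by
  obtain ⟨e, he⟩ := exists_orbitSum_adjoin G F hF hMid
  have : CompactSpace V := isCompact_iff_compactSpace.1 hV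
  let Φ : C(V, Fin nMid → ℝ) := ⟨fun x => sigmaPi G (inputTransform (monomialFeature e) x),
    (continuous_sigmaPi_inputTransform G (continuous_monomialFeature e)).comp
      continuous_subtype_val⟩
  have hfac : Function.FactorsThrough f Φ := by
    intro x y hxy
    obtain ⟨g, hg, hgy⟩ := exists_permuteRows_of_eval_eq G
      (x := (x : Fin n → Fin nIn → ℝ)) (y := y) fun p hp => by
        refine eval_eq_of_mem_adjoin ?_ (he hp)
        rintro _ ⟨k, rfl⟩
        simp only [← sigmaPi_monomialFeature]
        exact congrFun hxy k
    have hmem : permuteRows g (x : Fin n → Fin nIn → ℝ) ∈ V := hgy ▸ y.2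
    rw [← hinv g hg x hmem]
    exact congrArg f (Subtype.ext hgy.symm)
  obtain ⟨g, hg⟩ := Φ.exists_eq_comp_of_factorsThrough ⟨f, hf⟩ hfac
  have : CompactSpace (Set.range Φ) :=
    isCompact_iff_compactSpace.1 (isCompact_range Φ.continuous)
  obtain ⟨fout, hfout, hgf⟩ := exists_network_dist_lt (Set.range Φ) hσ g (half_pos hε)
  -- `fout` is fixed before the input networks, whose accuracy depends on it.
  obtain ⟨φ, hφ, hφV⟩ := exists_network_inputTransform G hτ hV (continuous_monomialFeature e)
    (hfout.continuous hσ.1) (half_pos hε)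
  refine ⟨fun x => fout (sigmaPi G (inputTransform φ x)), ⟨φ, fout, hφ, hfout, fun _ => rfl⟩,
    fun x => ?_⟩
  have h1 : |f x - fout (Φ x)| < ε / 2 := by
    have := hgf ⟨Φ x, x, rfl⟩
    rwa [hg x] at this
  exact (abs_sub_le _ (fout (Φ x)) _).trans_lt ((add_lt_add h1 (hφV x x.2)).trans_eq (add_halves ε))
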